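/- **Setting.** Let $\mathcal X\subseteq\mathbb R^n$ be a measurable set of finite positive Lebesgue measure, let $\mathrm P_x$ be the uniform probability distribution on $\mathcal X$, and let $f:\mathbb R^n\to\mathbb R^n$ be continuous (the system is $x(t+1)=f(x(t))$). Let $\epsilon_0>0$, $\gamma\in(0,1)$, $\overline\lambda\in\mathbb R$, $U_1,\dots,U_m\ge\epsilon_0$, and put $B=\prod_{l=1}^m[-U_l,U_l]$. Let $x_0\in\mathcal X$ be such that $V\cap\mathcal X$ has positive Lebesgue measure for every neighbourhood $V$ of $x_0$ (for instance, $x_0$ in the interior of $\mathcal X$). Let $h:\mathbb R^m\times\mathbb R^n\to\mathbb R$ be such that $a\mapsto h(a,x)$ is affine for every $x$; for every $a$ the function $h(a,\cdot)$ is measurable, and continuous on $\mathcal X$; and $h(a,x)<0$ for all $x\notin\mathcal X$ and $a\in B$. Fix states $x'_1,\dots,x'_{N'}\in\mathcal X$. For a sample set $\mathbb X=(x_1,\dots,x_N)\in\mathcal X^N$, $N\ge 1$, consider the linear program $$\min_{a\in\mathbb R^m,\ \lambda\in\mathbb R}\ \lambda\quad\text{s.t.}\quad h(a,x_0)\ge\epsilon_0,\quad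 h(a,f(x_i))\ge\gamma h(a,x_i)-\lambda\ (i=1,\dots,N),\quad \lambda\in[0,\overline\lambda],\quad a\in B,\tag{1}$$ and the tie-break program $$\max_{a\in\mathbb R^m}\ \sum_{i=1}^{N'}h(a,x'_i)\quad\text{s.t.}\quad h(a,x_0)\ge\epsilon_0,\quad h(a,f(x_i))\ge\gamma h(a,x_i)\ (i=1,\dots,N),\quad a\in B.\tag{2}$$ Assume that (1) is feasible for every $\mathbb X\in\mathcal X^N$. Let $(a^*(\mathbb X),\lambda^*(\mathbb X))$ be an optimal solution of (1) where, if $\lambda^*(\mathbb X)=0$, $a^*(\mathbb X)$ is moreover an optimal solution of (2); assume that, for $\mathrm P_x^N$-almost every $\mathbb X$ with $\lambda^*(\mathbb X)=0$, the optimal solution of (2) is unique. Put $\widetilde{\mathbb S}(\mathbb X)=\{x\in\mathcal X\mid h(a^*(\mathbb X),x)\ge0\}$. **Proposition.** Let $\alpha,\beta\in(0,1)$ and $\alpha\ge\frac2N\left(\ln\frac1\beta+m+1\right)$. If $\mathbb X=(x_1,\dots,x_N)$ is drawn i.i.d. from $\mathrm P_x$, then with confidence at least $1-\beta$ (that is,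 for all $\mathbb X$ in a measurable set of $\mathrm P_x^N$-probability at least $1-\beta$) the following holds: if $\lambda^*(\mathbb X)=0$, then $\mathrm P_x[x\in\widetilde{\mathbb S}(\mathbb X)]>0$ and $$\mathrm P_x\big[f(x)\in\widetilde{\mathbb S}(\mathbb X)\mid x\in\widetilde{\mathbb S}(\mathbb X)\big]\ \ge\ 1-\frac{\alpha}{\mathrm P_x[x\in\widetilde{\mathbb S}(\mathbb X)]}.$$ -/

import Mathlib

open MeasureTheory ProbabilityTheory Topology

namespace PACInvariance

/-- The state space `ℝⁿ`. -/
abbrev State (n : ℕ) := EuclideanSpace ℝ (Fin n)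

/-- The parameter space `ℝᵐ`. -/
abbrev Param (m : ℕ) := Fin m → ℝ

/-- The uniform probability distribution on a set of finite positive Lebesgue measure
(normalized Lebesgue measure). -/
noncomputable def uniformDist {n : ℕ} (𝒳 : Set (State n)) : Measure (State n) :=
  (volume : Measure (State n))[|𝒳]

/-- The law of `N` i.i.d. samples drawn uniformly from `𝒳`. -/
noncomputable def sampleDist {n : ℕ} (𝒳 : Set (State n)) (N : ℕ) :
    Measure (Fin N → State n) :=
  Measure.pi fun _ => uniformDist 𝒳

/-- The box `a_l ∈ [-U_l, U_l]`, `l = 1, …, m`. -/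
def InBox {m : ℕ} (U : Fin m → ℝ) (a : Param m) : Prop :=
  ∀ l, a l ∈ Set.Icc (-U l) (U l)

/-- Feasibility of `(a, lam)` for the sampled linear program. -/
def LPFeasible {n m N : ℕ} (f : State n → State n) (h : Param m → State n → ℝ)
    (x₀ : State n) (ε₀ γ lamBar : ℝ) (U : Fin m → ℝ) (X : Fin N → State n)
    (a : Param m) (lam : ℝ) : Prop :=
  ε₀ ≤ h a x₀ ∧ (∀ i, γ * h a (X i) - lam ≤ h a (f (X i))) ∧
    lam ∈ Set.Icc 0 lamBar ∧ InBox U a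

/-- `(a, lam)` is an optimal solution of the sampled linear program, which minimizes `lam`. -/
def IsLPOptimal {n m N : ℕ} (f : State n → State n) (h : Param m → State n → ℝ)
    (x₀ : State n) (ε₀ γ lamBar : ℝ) (U : Fin m → ℝ) (X : Fin N → State n)
    (a : Param m) (lam : ℝ) : Prop :=
  LPFeasible f h x₀ ε₀ γ lamBar U X a lam ∧
    ∀ a' lam', LPFeasible f h x₀ ε₀ γ lamBar U X a' lam' → lam ≤ lam'

/-- Feasibility of `a` for the tie-break program. -/
def TieBreakFeasible {n m N : ℕ} (f : State n → State n) (h : Param m → State n → ℝ)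
    (x₀ : State n) (ε₀ γ : ℝ) (U : Fin m → ℝ) (X : Fin N → State n) (a : Param m) : Prop :=
  ε₀ ≤ h a x₀ ∧ (∀ i, γ * h a (X i) ≤ h a (f (X i))) ∧ InBox U a

/-- `a` is an optimal solution of the tie-break program, which maximizes `∑ i, h (a, x' i)`
over the fixed states `x' i`. -/
def IsTieBreakOptimal {n m N N' : ℕ} (f : State n → State n) (h : Param m → State n → ℝ)
    (x₀ : State n) (ε₀ γ : ℝ) (U : Fin m → ℝ) (x' : Fin N' → State n)
    (X : Fin N → State n) (a : Param m) : Prop :=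
  TieBreakFeasible f h x₀ ε₀ γ U X a ∧
    ∀ a', TieBreakFeasible f h x₀ ε₀ γ U X a' → ∑ i, h a' (x' i) ≤ ∑ i, h a (x' i)

/-- The zero-superlevel set of `h (a, ·)` within `𝒳`. -/
def superlevel {n m : ℕ} (𝒳 : Set (State n)) (h : Param m → State n → ℝ) (a : Param m) :
    Set (State n) :=
  {x | x ∈ 𝒳 ∧ 0 ≤ h a x}

end PACInvariance

/-!
Call a set `R` of samples *good* for a sample set `X` if the optimum computed from the samples in
`R` alone is the optimum for all of `X`. By Helly's theorem an optimum in dimension `d` is already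
determined by some `d` of the samples, so at least `2 ^ (N - d)` of the `2 ^ N` subsets are good.
For a fixed `R`, the samples outside `R` are independent of the optimum computed from `R`, so the
probability that this optimum is violated with probability more than `α`, yet by none of the
samples outside `R`, is at most `(1 - α) ^ (N - |R|)`. Double counting over `R` bounds the
probability that the optimum for `X` has violation probability more than `α` by
`2 ^ d * ∑ R, (1 - α) ^ (N - |R|) / 2 ^ N = 2 ^ d * (1 - α / 2) ^ N`.

The program restricted to `R` may have several optima. Maximizing a strictly concave function
among them singles out one, which depends measurably on the samples in `R`.

A state of the superlevel set whose successor lies outside it violates the sampled constraint, so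
the violation probability bounds the probability of leaving the superlevel set in one step.
-/

namespace PACInvariance

section Confidence

variable {Ω : Type*} [MeasurableSpace Ω] {μ : Measure Ω}

/-- The property `p` holds with confidence at least `r` when drawing from `μ`. As `p` need not be
measurable, it is only required to hold on some measurable set of measure at least `r`. -/
def HoldsWithConfidence (μ : Measure Ω) (r : ℝ) (p : Ω → Prop) : Prop :=
  ∃ G, MeasurableSet G ∧ r ≤ μ.real G ∧ ∀ x ∈ G, p x

theorem holdsWithConfidence_iff [IsProbabilityMeasure μ] {r : ℝ} {p : Ω → Prop} :
    HoldsWithConfidence μ r p ↔ μ.real {x | ¬p x} ≤ 1 - r := by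
  constructor
  · rintro ⟨G, hG, hrG, hp⟩
    have hsub : {x | ¬p x} ⊆ Gᶜ := fun x hx hxG => hx (hp x hxG)
    have hle := measureReal_mono hsub (μ := μ)
    rw [probReal_compl_eq_one_sub hG] at hle
    linarith
  · intro hp
    refine ⟨(toMeasurable μ {x | ¬p x})ᶜ, (measurableSet_toMeasurable _ _).compl, ?_,
      fun x hx => not_not.1 fun hpx => hx (subset_toMeasurable _ _ hpx)⟩
    rw [probReal_compl_eq_one_sub (measurableSet_toMeasurable _ _), measureReal_def,
      measure_toMeasurable, ← measureReal_def]
    linarith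

theorem HoldsWithConfidence.mono_ae [IsProbabilityMeasure μ] {r r' : ℝ} {p q : Ω → Prop}
    (hp : HoldsWithConfidence μ r p) (hr : r' ≤ r) (hpq : ∀ᵐ x ∂μ, p x → q x) :
    HoldsWithConfidence μ r' q := by
  rw [holdsWithConfidence_iff] at hp ⊢
  have hle : μ.real {x | ¬q x} ≤ μ.real {x | ¬p x} :=
    ENNReal.toReal_mono (measure_ne_top _ _) <| measure_mono_ae <| by
      filter_upwards [hpq] with x hx using mt hx
  linarith

end Confidence

section Argmax

/-- The set of maximizers of `c` over `S`. -/
def argmaxOn {E β : Type*} [Preorder β] (c : E → β) (S : Set E) : Set E :=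
  {a ∈ S | IsMaxOn c S a}

variable {E : Type*}

theorem argmaxOn_toLex (c q : E → ℝ) (S : Set E) :
    argmaxOn (fun a => toLex (c a, q a)) S = argmaxOn q (argmaxOn c S) := by
  ext a
  simp only [argmaxOn, isMaxOn_iff, Set.mem_ofPred_eq, Prod.Lex.toLex_le_toLex]
  constructor
  · rintro ⟨haS, ha⟩
    have hc : ∀ b ∈ S, c b ≤ c a := fun b hb => (ha b hb).elim le_of_lt fun h => h.1.le
    refine ⟨⟨haS, hc⟩, fun b hb => ?_⟩
    exact (ha b hb.1).elim (fun h => absurd (hb.2 a haS) (not_le.2 h)) And.right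
  · rintro ⟨⟨haS, hc⟩, hq⟩
    refine ⟨haS, fun b hb => (hc b hb).lt_or_eq.imp_right fun h => ⟨h, hq b ⟨hb, ?_⟩⟩⟩
    exact h ▸ hc

section Topology

variable [TopologicalSpace E] {c : E → ℝ} {S : Set E}

theorem isCompact_argmaxOn (hS : IsCompact S) (hc : Continuous c) : IsCompact (argmaxOn c S) := by
  have heq : argmaxOn c S = S ∩ ⋂ b ∈ S, {a | c b ≤ c a} := by
    ext a
    simp [argmaxOn, isMaxOn_iff]
  rw [heq]
  exact hS.inter_right <| isClosed_biInter fun b _ => isClosed_le continuous_const hc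

/-- Only rational levels `t` occur, so that for varying `S` this is a countable combination of
conditions on which closed sets `S` hits. -/
theorem nonempty_argmaxOn_inter_iff (hS : IsCompact S) (hc : Continuous c) {C : Set E}
    (hC : IsClosed C) :
    (argmaxOn c S ∩ C).Nonempty ↔ (S ∩ C).Nonempty ∧
      ∀ t : ℚ, (S ∩ {a | t ≤ c a}).Nonempty → (S ∩ (C ∩ {a | t ≤ c a})).Nonempty := by
  constructor
  · rintro ⟨a, ⟨haS, ha⟩, haC⟩
    have hac : ∀ b ∈ S, c b ≤ c a := isMaxOn_iff.1 ha
    exact ⟨⟨a, haS, haC⟩, fun t ⟨b, hbS, hb⟩ =>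
      ⟨a, haS, haC, le_trans (Set.mem_ofPred.1 hb) (hac b hbS)⟩⟩
  · rintro ⟨hne, hlevel⟩
    obtain ⟨a, ⟨haS, haC⟩, ha⟩ := (hS.inter_right hC).exists_isMaxOn hne hc.continuousOn
    refine ⟨a, ⟨haS, isMaxOn_iff.2 fun b hbS => ?_⟩, haC⟩
    by_contra! hab
    obtain ⟨t, hat, htb⟩ := exists_rat_btwn hab
    obtain ⟨d, hdS, hdC, htd⟩ := hlevel t ⟨b, hbS, htb.le⟩
    exact absurd (htd.trans (ha ⟨hdS, hdC⟩)) (not_le.2 hat)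

end Topology

section Convexity

variable [AddCommGroup E] [Module ℝ E] {c q : E → ℝ} {S : Set E}

theorem convex_argmaxOn (hS : Convex ℝ S) (hc : ConcaveOn ℝ Set.univ c) :
    Convex ℝ (argmaxOn c S) := by
  have heq : argmaxOn c S = S ∩ ⋂ b ∈ S, {a | a ∈ Set.univ ∧ c b ≤ c a} := by
    ext a
    simp [argmaxOn, isMaxOn_iff]
  rw [heq]
  exact hS.inter <| convex_iInter₂ fun b _ => hc.convex_ge (c b)

theorem subsingleton_argmaxOn (hS : Convex ℝ S) (hq : StrictConcaveOn ℝ Set.univ q) :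
    (argmaxOn q S).Subsingleton := fun _ ha _ hb =>
  (hq.subset (Set.subset_univ S) hS).eq_of_isMaxOn ha.2 hb.2 ha.1 hb.1

theorem subsingleton_argmaxOn_toLex (hS : Convex ℝ S) (hc : ConcaveOn ℝ Set.univ c)
    (hq : StrictConcaveOn ℝ Set.univ q) :
    (argmaxOn (fun a => toLex (c a, q a)) S).Subsingleton := by
  rw [argmaxOn_toLex]
  exact subsingleton_argmaxOn (convex_argmaxOn hS hc) hq

theorem convex_setOf_toLex_lt (hc : ConcaveOn ℝ Set.univ c) (hq : ConcaveOn ℝ Set.univ q)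
    (u v : ℝ) : Convex ℝ {b | toLex (u, v) < toLex (c b, q b)} := by
  refine convex_iff_forall_pos.2 fun x hx y hy s t hs ht hst => ?_
  simp only [Set.mem_ofPred_eq, Prod.Lex.toLex_lt_toLex] at hx hy ⊢
  have hcst : s * c x + t * c y ≤ c (s • x + t • y) :=
    hc.2 (Set.mem_univ x) (Set.mem_univ y) hs.le ht.le hst
  have hqst : s * q x + t * q y ≤ q (s • x + t • y) :=
    hq.2 (Set.mem_univ x) (Set.mem_univ y) hs.le ht.le hst
  obtain rfl : t = 1 - s := by linarith
  rcases hx with hx | ⟨hx, hx'⟩ <;> rcases hy with hy | ⟨hy, hy'⟩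
  · left; nlinarith
  · left; nlinarith
  · left; nlinarith
  · rw [← hx, ← hy] at hcst
    have hle : u ≤ c (s • x + (1 - s) • y) := by linarith
    exact hle.lt_or_eq.imp_right fun h => ⟨h, by nlinarith⟩

end Convexity

end Argmax

section MeasurableSelection

variable {Ω E : Type*} [MeasurableSpace Ω]

/-- Measurability of a set-valued map: hitting any given closed set is a measurable event. This is
the notion that makes measurable selection work for closed-valued maps. -/
def MeasurableHits [TopologicalSpace E] (S : Ω → Set E) : Prop :=
  ∀ C, IsClosed C → MeasurableSet {ω | (S ω ∩ C).Nonempty}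

theorem MeasurableHits.argmaxOn [TopologicalSpace E] {S : Ω → Set E} (hS : MeasurableHits S)
    (hSc : ∀ ω, IsCompact (S ω)) {c : E → ℝ} (hc : Continuous c) :
    MeasurableHits fun ω => argmaxOn c (S ω) := by
  intro C hC
  have hlevel : ∀ t : ℚ, IsClosed {a | (t : ℝ) ≤ c a} := fun t => isClosed_le continuous_const hc
  simp only [nonempty_argmaxOn_inter_iff (hSc _) hc hC, Set.ofPred_and, Set.ofPred_forall]
  exact (hS C hC).inter <| MeasurableSet.iInter fun t =>
    (hS _ (hlevel t)).imp (hS _ (hC.inter (hlevel t)))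

theorem MeasurableHits.exists_measurable_mem [TopologicalSpace E] [MeasurableSpace E]
    [BorelSpace E] [Nonempty E] {S : Ω → Set E} (hS : MeasurableHits S)
    (hsub : ∀ ω, (S ω).Subsingleton) :
    ∃ s : Ω → E, Measurable s ∧ ∀ ω, (S ω).Nonempty → s ω ∈ S ω := by
  classical
  obtain ⟨e⟩ := ‹Nonempty E›
  let s : Ω → E := fun ω => if hω : (S ω).Nonempty then hω.some else e
  have hs : ∀ ω, (S ω).Nonempty → s ω ∈ S ω := fun ω hω => by
    simpa only [s, dif_pos hω] using hω.some_mem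
  refine ⟨s, measurable_of_isClosed fun C hC => ?_, hs⟩
  have hpre : s ⁻¹' C = {ω | (S ω ∩ C).Nonempty} ∪
      ({ω | (S ω ∩ Set.univ).Nonempty}ᶜ ∩ {_ω | e ∈ C}) := by
    ext ω
    by_cases hω : (S ω).Nonempty
    · have hSω : S ω = {s ω} := (hsub ω).eq_singleton_of_mem (hs ω hω)
      simp [hSω]
    · simp [Set.not_nonempty_iff_eq_empty.1 hω, s]
  rw [hpre]
  exact (hS C hC).union ((hS _ isClosed_univ).compl.inter (MeasurableSet.const _))

theorem measurableSet_exists_mem_forall_nonneg [PseudoMetricSpace E] {ι : Type*} [Finite ι]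
    {K : Set E} (hK : IsCompact K) {F : ι → E → Ω → ℝ} (hFc : ∀ i ω, Continuous fun a => F i a ω)
    (hFm : ∀ i a, Measurable (F i a)) : MeasurableSet {ω | ∃ a ∈ K, ∀ i, 0 ≤ F i a ω} := by
  have : TopologicalSpace.SeparableSpace K := hK.isSeparable.separableSpace
  obtain ⟨D, hDc, hD⟩ := TopologicalSpace.exists_countable_dense K
  -- The relaxed strict inequalities define an open set, which meets a dense set if nonempty.
  have hiff : ∀ ω, (∃ a ∈ K, ∀ i, 0 ≤ F i a ω) ↔
      ∀ n : ℕ, ∃ d ∈ D, ∀ i, -(1 / ((n : ℝ) + 1)) < F i d ω := by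
    refine fun ω => ⟨fun ⟨a, haK, ha⟩ n => ?_, fun hω => ?_⟩
    · have hopen : IsOpen {d : K | ∀ i, -(1 / ((n : ℝ) + 1)) < F i d ω} := by
        simp only [Set.ofPred_forall]
        exact isOpen_iInter_of_finite fun i =>
          isOpen_lt continuous_const ((hFc i ω).comp continuous_subtype_val)
      obtain ⟨d, hd, hdD⟩ := hD.inter_open_nonempty _ hopen
        ⟨⟨a, haK⟩, fun i => (neg_neg_of_pos Nat.one_div_pos_of_nat).trans_le (ha i)⟩
      exact ⟨d, hdD, hd⟩
    · choose d _ hd using hω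
      obtain ⟨a, haK, φ, hφ, hlim⟩ := hK.tendsto_subseq fun n => (d n).2
      have hzero : Filter.Tendsto (fun n : ℕ => -(1 / ((n : ℝ) + 1))) Filter.atTop (𝓝 0) := by
        simpa using (tendsto_one_div_add_atTop_nhds_zero_nat (𝕜 := ℝ)).neg
      exact ⟨a, haK, fun i => le_of_tendsto_of_tendsto' (hzero.comp hφ.tendsto_atTop)
        (((hFc i ω).tendsto a).comp hlim) fun n => (hd (φ n) i).le⟩
  have heq : {ω | ∃ a ∈ K, ∀ i, 0 ≤ F i a ω} =
      ⋂ n : ℕ, ⋃ d ∈ D, ⋂ i, {ω | -(1 / ((n : ℝ) + 1)) < F i d ω} := by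
    ext ω
    simpa using hiff ω
  rw [heq]
  exact MeasurableSet.iInter fun n => MeasurableSet.biUnion hDc fun d _ =>
    MeasurableSet.iInter fun i => measurableSet_lt measurable_const (hFm i d)

end MeasurableSelection

section ConvexProgram

/-- The feasible set of the sampled program: the points of `K` at which the constraint of each
sample `X i` holds. -/
def feasibleSet {Ω E ι : Type*} (K : Set E) (G : E → Ω → ℝ) (X : ι → Ω) : Set E :=
  {a | a ∈ K ∧ ∀ i, 0 ≤ G a (X i)}

theorem isCompact_feasibleSet {Ω E ι : Type*} [TopologicalSpace E] {K : Set E} (hK : IsCompact K)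
    {G : E → Ω → ℝ} (hG : ∀ x, Continuous fun a => G a x) (X : ι → Ω) :
    IsCompact (feasibleSet K G X) := by
  have heq : feasibleSet K G X = K ∩ ⋂ i, {a | 0 ≤ G a (X i)} := by
    ext a
    simp [feasibleSet]
  rw [heq]
  exact hK.inter_right <| isClosed_iInter fun i => isClosed_le continuous_const (hG (X i))

theorem measurableHits_feasibleSet {Ω E ι : Type*} [MeasurableSpace Ω] [PseudoMetricSpace E]
    [Finite ι] {K : Set E} (hK : IsCompact K) {G : E → Ω → ℝ}
    (hGc : ∀ x, Continuous fun a => G a x) (hGm : ∀ a, Measurable (G a)) :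
    MeasurableHits fun X : ι → Ω => feasibleSet K G X := by
  intro C hC
  have heq : {X : ι → Ω | (feasibleSet K G X ∩ C).Nonempty} =
      {X | ∃ a ∈ K ∩ C, ∀ i, 0 ≤ G a (X i)} := by
    ext X
    exact exists_congr fun a => and_right_comm
  rw [heq]
  exact measurableSet_exists_mem_forall_nonneg (F := fun i a (X : ι → Ω) => G a (X i))
    (hK.inter_right hC) (fun i X => hGc (X i)) fun i a => (hGm a).comp (measurable_pi_apply i)

theorem exists_finset_card_le_finrank_inter_biInter_eq_empty {E ι : Type*} [Finite ι]
    [AddCommGroup E] [Module ℝ E] [FiniteDimensional ℝ E] {T : Set E} (hT : Convex ℝ T)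
    {C : ι → Set E} (hC : ∀ i, Convex ℝ (C i)) (hne : (⋂ i, C i).Nonempty)
    (hempty : T ∩ ⋂ i, C i = ∅) :
    ∃ S : Finset ι, S.card ≤ Module.finrank ℝ E ∧ T ∩ ⋂ i ∈ S, C i = ∅ := by
  classical
  have := Fintype.ofFinite ι
  -- Helly's theorem for `C` together with `T` yields `d + 1` sets, one of which must be `T`.
  let F : Option ι → Set E := fun o => o.elim T C
  have hF : ∀ o ∈ (Finset.univ : Finset (Option ι)), Convex ℝ (F o) := by
    rintro (_ | i) -
    exacts [hT, hC i]
  have hF_empty : ¬(⋂ o ∈ (Finset.univ : Finset (Option ι)), F o).Nonempty := by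
    simpa [F, Set.iInter_option, Set.not_nonempty_iff_eq_empty] using hempty
  have hHelly := mt (Convex.helly_theorem' hF) hF_empty
  push Not at hHelly
  obtain ⟨I, -, hIcard, hI⟩ := hHelly
  have hnone : none ∈ I := by
    by_contra hnone
    obtain ⟨a, ha⟩ := hne
    refine Set.notMem_empty a (hI ▸ Set.mem_iInter₂.2 ?_)
    rintro (_ | i) ho
    exacts [absurd ho hnone, Set.mem_iInter.1 ha i]
  refine ⟨Finset.eraseNone I, ?_, ?_⟩
  · have := Finset.card_eraseNone_of_mem hnone
    omega
  · rw [← hI]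
    ext b
    simp [Option.forall, F, hnone]

theorem exists_strictConcaveOn (E : Type*) [NormedAddCommGroup E] [NormedSpace ℝ E]
    [FiniteDimensional ℝ E] : ∃ q : E → ℝ, StrictConcaveOn ℝ Set.univ q := by
  let F := EuclideanSpace ℝ (Fin (Module.finrank ℝ E))
  have hF : StrictConcaveOn ℝ Set.univ fun x : F => -‖x‖ ^ 2 := by
    refine StrongConcaveOn.strictConcaveOn (m := 2) (strongConcaveOn_iff_convex.2 ?_) two_pos
    simpa using concaveOn_const (0 : ℝ) convex_univ
  refine ⟨fun a => -‖toEuclidean a‖ ^ 2, ⟨convex_univ, fun x _ y _ hxy s t hs ht hst => ?_⟩⟩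
  simpa using hF.2 (Set.mem_univ _) (Set.mem_univ _) (toEuclidean.injective.ne hxy) hs ht hst

theorem convex_feasibleSet {Ω E ι : Type*} [AddCommGroup E] [Module ℝ E] {K : Set E}
    {G : E → Ω → ℝ} (hK : Convex ℝ K) (hG : ∀ x, ConcaveOn ℝ Set.univ fun a => G a x)
    (X : ι → Ω) : Convex ℝ (feasibleSet K G X) := by
  have heq : feasibleSet K G X = K ∩ ⋂ i, {a | a ∈ Set.univ ∧ 0 ≤ G a (X i)} := by
    ext a
    simp [feasibleSet]
  rw [heq]
  exact hK.inter <| convex_iInter fun i => (hG (X i)).convex_ge 0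

variable {Ω E ι : Type*} [NormedAddCommGroup E] [NormedSpace ℝ E] [FiniteDimensional ℝ E]
  {K : Set E} {G : E → Ω → ℝ} {c q : E → ℝ}

theorem exists_finset_forall_superset_mem_argmaxOn [Finite ι] (hK : Convex ℝ K)
    (hG : ∀ x, ConcaveOn ℝ Set.univ fun a => G a x) (hc : ConcaveOn ℝ Set.univ c)
    (hq : ConcaveOn ℝ Set.univ q) {X : ι → Ω} {a : E}
    (ha : a ∈ argmaxOn (fun a => toLex (c a, q a)) (feasibleSet K G X)) :
    ∃ S : Finset ι, S.card ≤ Module.finrank ℝ E ∧ ∀ R : Finset ι, S ⊆ R →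
      a ∈ argmaxOn (fun a => toLex (c a, q a)) (feasibleSet K G (R.restrict X)) := by
  obtain ⟨⟨haK, haX⟩, ha⟩ := ha
  have hmax : ∀ b ∈ feasibleSet K G X, toLex (c b, q b) ≤ toLex (c a, q a) := isMaxOn_iff.1 ha
  obtain ⟨S, hS, hSempty⟩ := exists_finset_card_le_finrank_inter_biInter_eq_empty
    (T := K ∩ {b | toLex (c a, q a) < toLex (c b, q b)})
    (C := fun i => {b | b ∈ Set.univ ∧ 0 ≤ G b (X i)})
    (hK.inter (convex_setOf_toLex_lt hc hq (c a) (q a))) (fun i => (hG (X i)).convex_ge 0)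
    ⟨a, Set.mem_iInter.2 fun i => ⟨Set.mem_univ a, haX i⟩⟩
    (Set.eq_empty_of_forall_notMem fun b ⟨⟨hbK, hab⟩, hb⟩ =>
      (hmax b ⟨hbK, fun i => (Set.mem_iInter.1 hb i).2⟩).not_gt hab)
  refine ⟨S, hS, fun R hSR => ⟨⟨haK, fun i => haX i⟩, isMaxOn_iff.2 fun b ⟨hbK, hb⟩ => ?_⟩⟩
  by_contra! hab
  have hbS : b ∈ ⋂ i ∈ S, {b | b ∈ Set.univ ∧ 0 ≤ G b (X i)} :=
    Set.mem_iInter₂.2 fun i hi => ⟨Set.mem_univ b, hb ⟨i, hSR hi⟩⟩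
  exact Set.notMem_empty b (hSempty ▸ ⟨⟨hbK, hab⟩, hbS⟩)

theorem exists_measurable_mem_argmaxOn_toLex [MeasurableSpace Ω] [MeasurableSpace E] [BorelSpace E]
    [Finite ι] (hKc : IsCompact K) (hK : Convex ℝ K)
    (hG : ∀ x, ConcaveOn ℝ Set.univ fun a => G a x) (hGm : ∀ a, Measurable (G a))
    (hc : ConcaveOn ℝ Set.univ c) (hq : StrictConcaveOn ℝ Set.univ q) :
    ∃ s : (ι → Ω) → E, Measurable s ∧ ∀ X,
      (argmaxOn (fun a => toLex (c a, q a)) (feasibleSet K G X)).Nonempty →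
        s X ∈ argmaxOn (fun a => toLex (c a, q a)) (feasibleSet K G X) := by
  have hGc : ∀ x, Continuous fun a => G a x := fun x => continuousOn_univ.1 <|
    (hG x).continuousOn isOpen_univ
  have hcc : Continuous c := continuousOn_univ.1 (hc.continuousOn isOpen_univ)
  have hqc : Continuous q := continuousOn_univ.1 (hq.concaveOn.continuousOn isOpen_univ)
  have hcomp : ∀ X : ι → Ω, IsCompact (feasibleSet K G X) := isCompact_feasibleSet hKc hGc
  have hhits : MeasurableHits fun X : ι → Ω =>
      argmaxOn (fun a => toLex (c a, q a)) (feasibleSet K G X) := by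
    simp only [argmaxOn_toLex]
    exact ((measurableHits_feasibleSet hKc hGc hGm).argmaxOn hcomp hcc).argmaxOn
      (fun X => isCompact_argmaxOn (hcomp X) hcc) hqc
  exact hhits.exists_measurable_mem fun X =>
    subsingleton_argmaxOn_toLex (convex_feasibleSet hK hG X) hc hq

end ConvexProgram

section Thinning

theorem measure_pi_le_of_forall_section_le {Ω ι : Type*} [MeasurableSpace Ω] [Fintype ι]
    {μ : Measure Ω} [IsProbabilityMeasure μ] {p : ι → Prop} [DecidablePred p] {B : Set (ι → Ω)}
    (hB : MeasurableSet B) {r : ENNReal}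
    (hr : ∀ y, Measure.pi (fun _ : {i // ¬p i} => μ)
      {z | (MeasurableEquiv.piEquivPiSubtypeProd (fun _ => Ω) p).symm (y, z) ∈ B} ≤ r) :
    Measure.pi (fun _ : ι => μ) B ≤ r := by
  have hpres := (measurePreserving_piEquivPiSubtypeProd (fun _ : ι => μ) p).symm
  rw [← hpres.measure_preimage hB.nullMeasurableSet,
    Measure.prod_apply ((MeasurableEquiv.measurable _) hB)]
  exact (lintegral_mono hr).trans (by simp)

theorem two_pow_card_mul_measure_le {Ω ι : Type*} [MeasurableSpace Ω] [Fintype ι] (μ : Measure Ω)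
    (d : ℕ) {B : Finset ι → Set Ω} (hB : ∀ R, MeasurableSet (B R)) :
    2 ^ Fintype.card ι * μ {x | ∃ S : Finset ι, S.card ≤ d ∧ ∀ R, S ⊆ R → x ∈ B R} ≤
      2 ^ d * ∑ R, μ (B R) := by
  classical
  let count : Ω → ENNReal := fun x => ∑ R, (B R).indicator 1 x
  have hcount : Measurable count :=
    Finset.measurable_sum _ fun R _ => measurable_one.indicator (hB R)
  have hle : ∀ x, (∃ S : Finset ι, S.card ≤ d ∧ ∀ R, S ⊆ R → x ∈ B R) →
      2 ^ Fintype.card ι ≤ 2 ^ d * count x := by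
    rintro x ⟨S, hSd, hS⟩
    have hsupersets : (2 : ENNReal) ^ (Fintype.card ι - S.card) ≤ count x :=
      calc (2 : ENNReal) ^ (Fintype.card ι - S.card)
          = ∑ R ∈ Finset.Icc S Finset.univ, 1 := by
            simp [Finset.card_Icc_finset (Finset.subset_univ S)]
        _ = ∑ R ∈ Finset.Icc S Finset.univ, (B R).indicator 1 x :=
            Finset.sum_congr rfl fun R hR => by
              rw [Set.indicator_of_mem (hS R (Finset.mem_Icc.1 hR).1), Pi.one_apply]
        _ ≤ count x := Finset.sum_le_sum_of_subset (Finset.subset_univ _)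
    calc (2 : ENNReal) ^ Fintype.card ι = 2 ^ S.card * 2 ^ (Fintype.card ι - S.card) := by
          rw [← pow_add, Nat.add_sub_cancel' (Finset.card_le_univ S)]
      _ ≤ 2 ^ d * count x := by
          gcongr
          exact one_le_two
  calc 2 ^ Fintype.card ι * μ {x | ∃ S : Finset ι, S.card ≤ d ∧ ∀ R, S ⊆ R → x ∈ B R}
      ≤ 2 ^ Fintype.card ι * μ {x | 2 ^ Fintype.card ι ≤ 2 ^ d * count x} :=
        mul_le_mul_right (measure_mono hle) _
    _ ≤ ∫⁻ x, 2 ^ d * count x ∂μ := mul_meas_ge_le_lintegral (hcount.const_mul _) _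
    _ = 2 ^ d * ∑ R, μ (B R) := by
        rw [lintegral_const_mul _ hcount,
          lintegral_finsetSum _ fun R _ => measurable_one.indicator (hB R)]
        simp only [lintegral_indicator_one (hB _)]

variable {Ω ι : Type*} [MeasurableSpace Ω] {μ : Measure Ω} {α : ℝ}

/-- The sample sets `X` for which the event `W`, evaluated at the samples in `R` and a fresh
sample, has probability more than `α` in the fresh sample, although none of the samples outside
`R` witnesses it. -/
def undetectedSet (μ : Measure Ω) (α : ℝ) (R : Finset ι) (W : Set ((R → Ω) × Ω)) : Set (ι → Ω) :=
  {X | α < μ.real {x | (R.restrict X, x) ∈ W} ∧ ∀ i ∉ R, (R.restrict X, X i) ∉ W}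

theorem measurableSet_undetectedSet [SFinite μ] [Finite ι] {R : Finset ι}
    {W : Set ((R → Ω) × Ω)} (hW : MeasurableSet W) : MeasurableSet (undetectedSet μ α R W) := by
  have hviol : Measurable fun X : ι → Ω => μ.real {x | (R.restrict X, x) ∈ W} :=
    ((measurable_measure_prodMk_left hW).comp (Finset.measurable_restrict R)).ennreal_toReal
  simp only [undetectedSet, Set.ofPred_and, Set.ofPred_forall]
  exact (measurableSet_lt measurable_const hviol).inter <| MeasurableSet.iInter fun i =>
    MeasurableSet.iInter fun _ =>
      (hW.preimage ((Finset.measurable_restrict R).prodMk (measurable_pi_apply i))).compl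

theorem measure_undetectedSet_le [IsProbabilityMeasure μ] [Fintype ι] {R : Finset ι}
    {W : Set ((R → Ω) × Ω)} (hW : MeasurableSet W) :
    Measure.pi (fun _ : ι => μ) (undetectedSet μ α R W) ≤
      ENNReal.ofReal (1 - α) ^ (Fintype.card ι - R.card) := by
  classical
  refine measure_pi_le_of_forall_section_le (p := (· ∈ R)) (measurableSet_undetectedSet hW)
    fun y => ?_
  let e := MeasurableEquiv.piEquivPiSubtypeProd (fun _ : ι => Ω) (· ∈ R)
  have hin : ∀ z, R.restrict (e.symm (y, z)) = y := fun z =>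
    congrArg Prod.fst (e.apply_symm_apply (y, z))
  have hout : ∀ z (i : {i // i ∉ R}), e.symm (y, z) i = z i := fun z i =>
    congrFun (congrArg Prod.snd (e.apply_symm_apply (y, z))) i
  have hWy : MeasurableSet {x | (y, x) ∈ W} := measurable_prodMk_left hW
  by_cases hy : α < μ.real {x | (y, x) ∈ W}
  · have hsection : {z | e.symm (y, z) ∈ undetectedSet μ α R W} ⊆
        Set.univ.pi fun _ => {x | (y, x) ∈ W}ᶜ := fun z hz i _ => by
      simpa only [hin, hout, Set.mem_compl_iff, Set.mem_ofPred_eq] using hz.2 i i.2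
    have hle : μ {x | (y, x) ∈ W}ᶜ ≤ ENNReal.ofReal (1 - α) := by
      rw [← ofReal_measureReal, probReal_compl_eq_one_sub hWy]
      exact ENNReal.ofReal_le_ofReal (by linarith)
    have hcard : Fintype.card {i // i ∉ R} = Fintype.card ι - R.card := by
      rw [Fintype.card_subtype_compl, Fintype.card_coe]
    calc _ ≤ _ := measure_mono hsection
      _ = μ {x | (y, x) ∈ W}ᶜ ^ (Fintype.card ι - R.card) := by
          rw [Measure.pi_pi, Finset.prod_const, Finset.card_univ, hcard]
      _ ≤ _ := pow_le_pow_left' hle _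
  · have hsection : {z | e.symm (y, z) ∈ undetectedSet μ α R W} = ∅ :=
      Set.eq_empty_of_forall_notMem fun z hz => hy (by simpa only [hin] using hz.1)
    rw [hsection, measure_empty]
    exact zero_le

theorem measureReal_forall_superset_mem_undetectedSet_le [IsProbabilityMeasure μ] [Fintype ι]
    (hα : α ≤ 1) (d : ℕ) {W : (R : Finset ι) → Set ((R → Ω) × Ω)}
    (hW : ∀ R, MeasurableSet (W R)) :
    (Measure.pi fun _ : ι => μ).real {X | ∃ S : Finset ι, S.card ≤ d ∧
      ∀ R, S ⊆ R → X ∈ undetectedSet μ α R (W R)} ≤ 2 ^ d * (1 - α / 2) ^ Fintype.card ι := by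
  set P := Measure.pi fun _ : ι => μ
  set D := {X | ∃ S : Finset ι, S.card ≤ d ∧ ∀ R, S ⊆ R → X ∈ undetectedSet μ α R (W R)}
  have hD : 2 ^ Fintype.card ι * P D ≤ 2 ^ d * (1 + ENNReal.ofReal (1 - α)) ^ Fintype.card ι :=
    calc 2 ^ Fintype.card ι * P D ≤ 2 ^ d * ∑ R, P (undetectedSet μ α R (W R)) :=
          two_pow_card_mul_measure_le P d fun R => measurableSet_undetectedSet (hW R)
      _ ≤ 2 ^ d * ∑ R : Finset ι, 1 ^ R.card *
            ENNReal.ofReal (1 - α) ^ (Fintype.card ι - R.card) := by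
          gcongr with R
          rw [one_pow, one_mul]
          exact measure_undetectedSet_le (hW R)
      _ = 2 ^ d * (1 + ENNReal.ofReal (1 - α)) ^ Fintype.card ι := by
          rw [Fintype.sum_pow_mul_eq_add_pow]
  have hDreal : 2 ^ Fintype.card ι * P.real D ≤ 2 ^ d * (1 + (1 - α)) ^ Fintype.card ι := by
    simpa [measureReal_def, ENNReal.toReal_add, ENNReal.toReal_ofReal (sub_nonneg.2 hα)] using
      ENNReal.toReal_mono (by finiteness) hD
  refine le_of_mul_le_mul_left (hDreal.trans_eq ?_) (pow_pos (two_pos (α := ℝ)) (Fintype.card ι))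
  rw [mul_left_comm, ← mul_pow]
  ring

end Thinning

section Scenario

variable {Ω E ι : Type*} [MeasurableSpace Ω] [NormedAddCommGroup E] [NormedSpace ℝ E]
  [FiniteDimensional ℝ E] [Fintype ι]

theorem holdsWithConfidence_measureReal_violation_le {μ : Measure Ω} [IsProbabilityMeasure μ]
    {K : Set E} (hKc : IsCompact K) (hK : Convex ℝ K) {G : E → Ω → ℝ}
    (hG : ∀ x, ConcaveOn ℝ Set.univ fun a => G a x) (hGm : ∀ a, Measurable (G a)) {c : E → ℝ}
    (hc : ConcaveOn ℝ Set.univ c) {α : ℝ} (hα : α ≤ 1) :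
    HoldsWithConfidence (Measure.pi fun _ : ι => μ)
      (1 - 2 ^ Module.finrank ℝ E * (1 - α / 2) ^ Fintype.card ι)
      fun X => ∀ a, argmaxOn c (feasibleSet K G X) = {a} → μ.real {x | G a x < 0} ≤ α := by
  borelize E
  obtain ⟨q, hq⟩ := exists_strictConcaveOn E
  choose s hs hs_mem using fun R : Finset ι =>
    exists_measurable_mem_argmaxOn_toLex (ι := R) hKc hK hG hGm hc hq
  let W : (R : Finset ι) → Set ((R → Ω) × Ω) := fun R => {p | G (s R p.1) p.2 < 0}
  have hW : ∀ R, MeasurableSet (W R) := fun R => by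
    have : ProperSpace E := FiniteDimensional.proper ℝ E
    have hGu : Measurable (Function.uncurry G) := measurable_uncurry_of_continuous_of_measurable
      (fun x => continuousOn_univ.1 ((hG x).continuousOn isOpen_univ)) hGm
    exact measurableSet_lt
      (hGu.comp (((hs R).comp measurable_fst).prodMk measurable_snd)) measurable_const
  rw [holdsWithConfidence_iff, sub_sub_cancel]
  refine (measureReal_mono fun X hX => ?_).trans
    (measureReal_forall_superset_mem_undetectedSet_le hα (Module.finrank ℝ E) hW)
  simp only [Set.mem_ofPred_eq, not_forall, not_le] at hX
  obtain ⟨a, ha, hviol⟩ := hX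
  have ha_mem : a ∈ argmaxOn (fun a => toLex (c a, q a)) (feasibleSet K G X) := by
    rw [argmaxOn_toLex, ha]
    exact ⟨rfl, fun b hb => (congrArg q hb).le⟩
  obtain ⟨S, hS, hSR⟩ := exists_finset_forall_superset_mem_argmaxOn hK hG hc hq.concaveOn ha_mem
  refine ⟨S, hS, fun R hR => ?_⟩
  have hsR : s R (R.restrict X) = a :=
    subsingleton_argmaxOn_toLex (convex_feasibleSet hK hG _) hc hq
      (hs_mem R _ ⟨a, hSR R hR⟩) (hSR R hR)
  refine ⟨by simpa only [W, Set.mem_ofPred_eq, hsR] using hviol, fun i _ => ?_⟩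
  simpa only [W, Set.mem_ofPred_eq, hsR, not_lt] using ha_mem.1.2 i

end Scenario

theorem two_pow_mul_one_sub_pow_le {m N : ℕ} {x β : ℝ} (hx : x ≤ 1) (hβ : 0 < β)
    (hN : Real.log (1 / β) + m ≤ N * x) : 2 ^ m * (1 - x) ^ N ≤ β := by
  have htwo : (2 : ℝ) ^ m ≤ Real.exp m := by
    rw [← Real.exp_one_pow]
    exact pow_le_pow_left₀ zero_le_two (by linarith [Real.add_one_le_exp (1 : ℝ)]) m
  have hpow : (1 - x) ^ N ≤ Real.exp (-(N * x)) := by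
    rw [← mul_neg, Real.exp_nat_mul]
    exact pow_le_pow_left₀ (sub_nonneg.2 hx) (Real.one_sub_le_exp_neg x) N
  calc (2 : ℝ) ^ m * (1 - x) ^ N ≤ Real.exp m * Real.exp (-(N * x)) :=
        mul_le_mul htwo hpow (pow_nonneg (sub_nonneg.2 hx) N) (Real.exp_pos m).le
    _ = Real.exp (m - N * x) := by rw [← Real.exp_add, sub_eq_add_neg]
    _ ≤ Real.exp (Real.log β) := by
        rw [one_div, Real.log_inv] at hN
        exact Real.exp_le_exp.2 (by linarith)
    _ = β := Real.exp_log hβ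

theorem one_sub_div_le_cond_real {Ω : Type*} [MeasurableSpace Ω] {μ : Measure Ω}
    [IsFiniteMeasure μ] {S T : Set Ω} (hS : MeasurableSet S) (hpos : 0 < μ.real S) {α : ℝ}
    (hα : μ.real (S \ T) ≤ α) : 1 - α / μ.real S ≤ (μ[|S]).real T := by
  have hsplit : μ.real S ≤ μ.real (S ∩ T) + μ.real (S \ T) := by
    conv_lhs => rw [← Set.inter_union_sdiff S T]
    exact measureReal_union_le _ _
  rw [measureReal_def (μ[|S]), cond_apply hS, ENNReal.toReal_mul, ENNReal.toReal_inv,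
    ← measureReal_def, ← measureReal_def, one_sub_div hpos.ne', div_eq_inv_mul]
  gcongr
  linarith

section Affine

variable {E : Type*} [AddCommGroup E] [Module ℝ E] {g : E → ℝ}

/-- An unbundled affine function, the form in which templates are given. -/
def IsAffine (g : E → ℝ) : Prop :=
  ∃ (φ : E →ₗ[ℝ] ℝ) (b : ℝ), ∀ a, g a = φ a + b

theorem IsAffine.convexOn (hg : IsAffine g) : ConvexOn ℝ Set.univ g := by
  obtain ⟨φ, b, hφ⟩ := hg
  exact funext hφ ▸ (φ.convexOn convex_univ).add_const b

theorem IsAffine.concaveOn (hg : IsAffine g) : ConcaveOn ℝ Set.univ g := by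
  obtain ⟨φ, b, hφ⟩ := hg
  exact funext hφ ▸ (φ.concaveOn convex_univ).add_const b

theorem IsAffine.sum {ι : Type*} [Fintype ι] {g : ι → E → ℝ} (hg : ∀ i, IsAffine (g i)) :
    IsAffine fun a => ∑ i, g i a := by
  choose φ b hφ using hg
  exact ⟨∑ i, φ i, ∑ i, b i, fun a => by simp [hφ, Finset.sum_add_distrib]⟩

end Affine

section Invariance

variable {Ω E : Type*}

/-- The slack of the invariance constraint `γ * h a x ≤ h a (f x)` at the state `x`. -/
def invarianceSlack (f : Ω → Ω) (h : E → Ω → ℝ) (γ : ℝ) (a : E) (x : Ω) : ℝ :=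
  h a (f x) - γ * h a x

variable {f : Ω → Ω} {h : E → Ω → ℝ} {γ : ℝ}

theorem concaveOn_invarianceSlack [AddCommGroup E] [Module ℝ E]
    (h_affine : ∀ x, IsAffine fun a => h a x) (hγ : 0 ≤ γ) (x : Ω) :
    ConcaveOn ℝ Set.univ fun a => invarianceSlack f h γ a x :=
  (h_affine (f x)).concaveOn.sub ((h_affine x).convexOn.smul hγ)

theorem measurable_invarianceSlack [MeasurableSpace Ω] (hf : Measurable f)
    {a : E} (h_meas : Measurable (h a)) : Measurable (invarianceSlack f h γ a) :=
  (h_meas.comp hf).sub (h_meas.const_mul γ)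

theorem setOf_nonneg_sdiff_preimage_subset (hγ : 0 ≤ γ) (a : E) :
    {x | 0 ≤ h a x} \ f ⁻¹' {x | 0 ≤ h a x} ⊆ {x | invarianceSlack f h γ a x < 0} := by
  rintro x ⟨hx, hfx⟩
  have hγx : 0 ≤ γ * h a x := mul_nonneg hγ hx
  have hneg : h a (f x) < 0 := not_le.1 hfx
  exact sub_neg.2 (hneg.trans_le hγx)

theorem measureReal_setOf_nonneg_pos [MeasurableSpace Ω] [TopologicalSpace Ω] {μ : Measure Ω}
    [IsFiniteMeasure μ] {𝒳 : Set Ω} {x₀ : Ω} (hx₀ : ∀ V ∈ 𝓝[𝒳] x₀, μ V ≠ 0) {g : Ω → ℝ}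
    (hg : ContinuousWithinAt g 𝒳 x₀) (hpos : 0 < g x₀) : 0 < μ.real {x | 0 ≤ g x} :=
  ENNReal.toReal_pos
    (hx₀ _ ((hg.eventually (lt_mem_nhds hpos)).mono fun _ => le_of_lt)) (measure_ne_top _ _)

end Invariance

section Sampling

variable {n m N N' : ℕ} {𝒳 : Set (State n)} {f : State n → State n}
  {h : Param m → State n → ℝ} {x₀ : State n} {ε₀ γ : ℝ} {U : Fin m → ℝ}

/-- The parameters satisfying those constraints of the programs that do not involve the samples. -/
def admissibleSet (h : Param m → State n → ℝ) (x₀ : State n) (ε₀ : ℝ) (U : Fin m → ℝ) :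
    Set (Param m) :=
  {a | ε₀ ≤ h a x₀ ∧ InBox U a}

theorem admissibleSet_eq_inter (h : Param m → State n → ℝ) (x₀ : State n) (ε₀ : ℝ)
    (U : Fin m → ℝ) :
    admissibleSet h x₀ ε₀ U = {a | a ∈ Set.univ ∧ ε₀ ≤ h a x₀} ∩ Set.Icc (-U) U := by
  ext a
  simp [admissibleSet, InBox, Pi.le_def, forall_and]

theorem convex_admissibleSet (h_affine : IsAffine fun a => h a x₀) :
    Convex ℝ (admissibleSet h x₀ ε₀ U) := by
  rw [admissibleSet_eq_inter]
  exact (h_affine.concaveOn.convex_ge ε₀).inter (convex_Icc _ _)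

theorem isCompact_admissibleSet (h_affine : IsAffine fun a => h a x₀) :
    IsCompact (admissibleSet h x₀ ε₀ U) := by
  have hcont : Continuous fun a => h a x₀ :=
    continuousOn_univ.1 (h_affine.concaveOn.continuousOn isOpen_univ)
  rw [admissibleSet_eq_inter]
  simpa using isCompact_Icc.inter_left (isClosed_le continuous_const hcont)

theorem isTieBreakOptimal_iff_mem_argmaxOn {x' : Fin N' → State n} {X : Fin N → State n}
    {a : Param m} :
    IsTieBreakOptimal f h x₀ ε₀ γ U x' X a ↔ a ∈ argmaxOn (fun a => ∑ i, h a (x' i))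
      (feasibleSet (admissibleSet h x₀ ε₀ U) (invarianceSlack f h γ) X) := by
  have hfeas : ∀ a, TieBreakFeasible f h x₀ ε₀ γ U X a ↔
      a ∈ feasibleSet (admissibleSet h x₀ ε₀ U) (invarianceSlack f h γ) X := fun a => by
    simp only [TieBreakFeasible, feasibleSet, admissibleSet, invarianceSlack, sub_nonneg,
      Set.mem_ofPred_eq]
    tauto
  simp only [IsTieBreakOptimal, hfeas, argmaxOn, isMaxOn_iff, Set.mem_ofPred_eq]

theorem superlevel_eq_setOf_nonneg {a : Param m} (h_neg : ∀ x, x ∉ 𝒳 → h a x < 0) :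
    superlevel 𝒳 h a = {x | 0 ≤ h a x} := by
  ext x
  exact and_iff_right_of_imp fun hx => by_contra fun hx𝒳 => (h_neg x hx𝒳).not_ge hx

theorem argmaxOn_eq_singleton_of_isTieBreakOptimal {x' : Fin N' → State n} {X : Fin N → State n}
    {a : Param m} (ha : IsTieBreakOptimal f h x₀ ε₀ γ U x' X a)
    (h_unique : ∀ b, IsTieBreakOptimal f h x₀ ε₀ γ U x' X b → b = a) :
    argmaxOn (fun a => ∑ i, h a (x' i))
      (feasibleSet (admissibleSet h x₀ ε₀ U) (invarianceSlack f h γ) X) = {a} := by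
  simp only [isTieBreakOptimal_iff_mem_argmaxOn] at ha h_unique
  exact Set.eq_singleton_iff_unique_mem.2 ⟨ha, h_unique⟩

theorem uniformDist_ne_zero_of_mem_nhdsWithin (h𝒳 : MeasurableSet 𝒳) (h𝒳_fin : volume 𝒳 ≠ ⊤)
    (hx₀ : ∀ V ∈ 𝓝 x₀, volume (V ∩ 𝒳) ≠ 0) {V : Set (State n)} (hV : V ∈ 𝓝[𝒳] x₀) :
    uniformDist 𝒳 V ≠ 0 := by
  obtain ⟨V', hV', hsub⟩ := mem_nhdsWithin_iff_exists_mem_nhds_inter.1 hV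
  have hle : volume (V' ∩ 𝒳) ≤ volume (𝒳 ∩ V) :=
    measure_mono fun x hx => ⟨hx.2, hsub hx⟩
  rw [uniformDist, cond_apply h𝒳]
  exact mul_ne_zero (ENNReal.inv_ne_zero.2 h𝒳_fin) fun h0 =>
    hx₀ V' hV' (le_zero_iff.1 (h0 ▸ hle))

end Sampling

end PACInvariance

open PACInvariance

theorem proposition3_general {Ω E ι : Type*} [TopologicalSpace Ω] [MeasurableSpace Ω]
    [NormedAddCommGroup E] [NormedSpace ℝ E] [FiniteDimensional ℝ E] [Fintype ι]
    {μ : Measure Ω} [IsProbabilityMeasure μ] {𝒳 : Set Ω} {f : Ω → Ω} (hf : Measurable f)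
    {x₀ : Ω} (hx₀ : ∀ V ∈ 𝓝[𝒳] x₀, μ V ≠ 0) {γ : ℝ} (hγ : 0 ≤ γ)
    {K : Set E} (hKc : IsCompact K) (hK : Convex ℝ K)
    {h : E → Ω → ℝ} (h_affine : ∀ x, IsAffine fun a => h a x)
    (h_pos : ∀ a ∈ K, 0 < h a x₀) (h_cont : ∀ a ∈ K, ContinuousWithinAt (h a) 𝒳 x₀)
    (h_meas : ∀ a, Measurable (h a)) {c : E → ℝ} (hc : ConcaveOn ℝ Set.univ c)
    {α : ℝ} (hα : α ≤ 1) :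
    HoldsWithConfidence (Measure.pi fun _ : ι => μ)
      (1 - 2 ^ Module.finrank ℝ E * (1 - α / 2) ^ Fintype.card ι)
      fun X => ∀ a, argmaxOn c (feasibleSet K (invarianceSlack f h γ) X) = {a} →
        0 < μ.real {x | 0 ≤ h a x} ∧
        1 - α / μ.real {x | 0 ≤ h a x} ≤ (μ[|{x | 0 ≤ h a x}]).real (f ⁻¹' {x | 0 ≤ h a x}) := by
  have hviol := holdsWithConfidence_measureReal_violation_le (μ := μ) (ι := ι) hKc hK
    (concaveOn_invarianceSlack (f := f) h_affine hγ)
    (fun a => measurable_invarianceSlack hf (h_meas a)) hc hα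
  refine hviol.mono_ae le_rfl (Filter.Eventually.of_forall fun X hX a ha => ?_)
  have haK : a ∈ K := (ha.symm.subset rfl).1.1
  have hpos := measureReal_setOf_nonneg_pos hx₀ (h_cont a haK) (h_pos a haK)
  refine ⟨hpos, one_sub_div_le_cond_real (measurableSet_le measurable_const (h_meas a)) hpos ?_⟩
  exact (measureReal_mono (setOf_nonneg_sdiff_preimage_subset hγ a)).trans (hX a ha)

theorem proposition3 {n m N N' : ℕ}
    -- the safe set, carrying the uniform distribution
    (𝒳 : Set (PACInvariance.State n)) (h𝒳 : MeasurableSet 𝒳)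
    (h𝒳_pos : volume 𝒳 ≠ 0) (h𝒳_fin : volume 𝒳 ≠ ⊤)
    -- the dynamics
    (f : PACInvariance.State n → PACInvariance.State n) (hf : Continuous f)
    -- the user-defined parameters and the box of admissible parameter vectors
    (x₀ : PACInvariance.State n) (hx₀ : x₀ ∈ 𝒳) (hx₀_nhds : ∀ V ∈ 𝓝 x₀, volume (V ∩ 𝒳) ≠ 0)
    (ε₀ γ lamBar : ℝ) (hε₀ : 0 < ε₀) (hγ : γ ∈ Set.Ioo (0 : ℝ) 1)
    (U : Fin m → ℝ) (hU : ∀ l, ε₀ ≤ U l)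
    -- the template: affine in the parameter, negative off the safe set, continuous on it
    (h : PACInvariance.Param m → PACInvariance.State n → ℝ)
    (h_affine : ∀ x, ∃ (φ : PACInvariance.Param m →ₗ[ℝ] ℝ) (b : ℝ), ∀ a, h a x = φ a + b)
    (h_neg : ∀ a, PACInvariance.InBox U a → ∀ x, x ∉ 𝒳 → h a x < 0)
    (h_cont : ∀ a, ContinuousOn (h a) 𝒳) (h_meas : ∀ a, Measurable (h a))
    -- the fixed states of the tie-break objective
    (x' : Fin N' → PACInvariance.State n) (hx' : ∀ i, x' i ∈ 𝒳)
    -- the solution of the linear program, for each sample set, with the tie-break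
    (aStar : (Fin N → PACInvariance.State n) → PACInvariance.Param m)
    (lamStar : (Fin N → PACInvariance.State n) → ℝ)
    (h_opt : ∀ X, (∀ i, X i ∈ 𝒳) →
      PACInvariance.IsLPOptimal f h x₀ ε₀ γ lamBar U X (aStar X) (lamStar X))
    (h_tie : ∀ X, (∀ i, X i ∈ 𝒳) → lamStar X = 0 →
      PACInvariance.IsTieBreakOptimal f h x₀ ε₀ γ U x' X (aStar X))
    (h_unique : ∀ᵐ X ∂PACInvariance.sampleDist 𝒳 N, lamStar X = 0 →
      ∀ a, PACInvariance.IsTieBreakOptimal f h x₀ ε₀ γ U x' X a → a = aStar X)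
    (α β : ℝ) (hα : α ∈ Set.Ioo (0 : ℝ) 1) (hβ : β ∈ Set.Ioo (0 : ℝ) 1) (hN : 0 < N)
    (hαN : 2 / (N : ℝ) * (Real.log (1 / β) + m + 1) ≤ α) :
    ∃ G : Set (Fin N → PACInvariance.State n), MeasurableSet G ∧
      1 - β ≤ (PACInvariance.sampleDist 𝒳 N).real G ∧
      ∀ X ∈ G, lamStar X = 0 →
        0 < (PACInvariance.uniformDist 𝒳).real (PACInvariance.superlevel 𝒳 h (aStar X)) ∧
        1 - α / (PACInvariance.uniformDist 𝒳).real (PACInvariance.superlevel 𝒳 h (aStar X)) ≤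
          ((PACInvariance.uniformDist 𝒳)[|PACInvariance.superlevel 𝒳 h (aStar X)]).real
            (f ⁻¹' PACInvariance.superlevel 𝒳 h (aStar X)) := by
  have : IsProbabilityMeasure (uniformDist 𝒳) := cond_isProbabilityMeasure_of_finite h𝒳_pos h𝒳_fin
  have hmem : ∀ᵐ X ∂sampleDist 𝒳 N, ∀ i, X i ∈ 𝒳 := ae_all_iff.2 fun _ =>
    Measure.tendsto_eval_ae_ae.eventually (ae_cond_mem h𝒳)
  have hbound : 2 ^ m * (1 - α / 2) ^ N ≤ β := by
    refine two_pow_mul_one_sub_pow_le (by linarith [hα.2]) hβ.1 ?_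
    field_simp at hαN ⊢
    linarith
  have hgeneral := proposition3_general (ι := Fin N) (μ := uniformDist 𝒳) hf.measurable
    (fun V => uniformDist_ne_zero_of_mem_nhdsWithin h𝒳 h𝒳_fin hx₀_nhds) hγ.1.le
    (isCompact_admissibleSet (U := U) (h_affine x₀)) (convex_admissibleSet (h_affine x₀)) h_affine
    (fun a ha => hε₀.trans_le ha.1) (fun a _ => h_cont a x₀ hx₀) h_meas
    (IsAffine.sum fun i => h_affine (x' i)).concaveOn hα.2.le
  rw [Module.finrank_fin_fun, Fintype.card_fin] at hgeneral
  refine hgeneral.mono_ae (sub_le_sub_left hbound 1) ?_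
  filter_upwards [hmem, h_unique] with X hX hu hprogram hlam
  have htie := h_tie X hX hlam
  rw [superlevel_eq_setOf_nonneg (h_neg _ htie.1.2.2)]
  exact hprogram _ (argmaxOn_eq_singleton_of_isTieBreakOptimal htie (hu hlam))
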